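/- **Stochastic $k$-TSP.** An instance is a finite metric space $(V,d)$ with a depot $r_0\in V$, a target $k\in\mathbb{Z}_{\ge 0}$, and for every $v\in V$ a known distribution on $\{0,1,\dots,k\}$; the rewards $R_v$ are independent with these distributions, and $R_v$ is revealed (and collected, once) when $v$ is visited. An *adaptive policy* is a decision tree that chooses the next vertex to visit depending on the rewards observed so far; it must almost surely end with total collected reward at least $k$ or with all vertices visited, and its cost is the expected length of the resulting closed tour from $r_0$. A *non-adaptive policy* is a list of distinct vertices, visited in that order until the collected reward reaches $k$ (or the list is exhausted), subject to the same feasibility requirement. The *adaptivity gap* is the supremum over instances of the ratio of the optimal (infimum) expected non-adaptive cost to the optimal (infimum) expected adaptive cost. In *stochastic knapsack cover* the vertices are items with non-negative costs, and the cost of a policy is the expected total cost of the chosen items, everything else being as above; it corresponds to $k$-TSP on a weighted star rooted at the depot. **Theorem.** For $n\ge 1$ and a probability distribution $p=(p_1,\dots,p_n)$ on $\{1,\dots,n\}$ let $\mathcal{I}_{n,p}$ be the stochastic knapsack cover instance with target $k=2^{n+1}$, one random item of cost $0$ whose reward is $2^{n+1}-2^i$ with probability $p_i$ $(1\le i\le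 n)$, and $n$ deterministic items $u_1,\dots,u_n$, where $u_i$ has cost $i$ and reward $2^i$. 1. There are real numbers $\delta_n\to 0$ $(n\to\infty)$ such that for every $n\ge 1$ there is a distribution $p$ on $\{1,\dots,n\}$ for which the optimal adaptive cost of $\mathcal{I}_{n,p}$ is positive and the optimal non-adaptive cost of $\mathcal{I}_{n,p}$ is at least $(e-\delta_n)$ times the optimal adaptive cost. 2. Consequently, the adaptivity gap of stochastic knapsack cover, restricted to instances with at most one random (non-deterministic) item, is at least $e$. 3. The adaptivity gap of stochastic $k$-TSP is at least $e$, even when restricted to instances whose metric is a weighted star centred at the depot and in which at most one vertex has a random reward. -/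

import Mathlib

open Filter Topology
open scoped ENNReal NNReal

noncomputable section

/-- A covering target together with the distributions of the rewards at the vertices (or items)
in `V`. Rewards are supported on `{0, …, target}`; rewards of distinct vertices are independent,
see `RewardModel.weight`. -/
structure RewardModel (V : Type) where
  target : ℕ
  reward : V → PMF (Fin (target + 1))

/-- An adaptive policy as a decision tree: either halt, or visit `v`, observe its reward
`j ∈ {0, …, k}`, and continue with the `j`-th subtree. -/
inductive DecisionTree (V : Type) (k : ℕ) : Type
  | halt : DecisionTree V k
  | visit (v : V) (next : Fin (k + 1) → DecisionTree V k) : DecisionTree V k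

/-- The sequence of vertices visited by a decision tree when the rewards are given by `ρ`. -/
def DecisionTree.visited {V : Type} {k : ℕ} (ρ : V → Fin (k + 1)) : DecisionTree V k → List V
  | .halt => []
  | .visit v next => v :: DecisionTree.visited ρ (next (ρ v))

/-- The vertices visited when a list is followed in order until a residual target is met (or until
the list is exhausted), when the rewards are given by `ρ`. -/
def visitUntil {V : Type} {k : ℕ} (ρ : V → Fin (k + 1)) : ℕ → List V → List V
  | _, [] => []
  | m, v :: τ => if m = 0 then [] else v :: visitUntil ρ (m - (ρ v : ℕ)) τ

namespace RewardModel

variable {V : Type} [Fintype V] (M : RewardModel V)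

/-- The probability of a joint realization `ρ` of the independent rewards. -/
def weight (ρ : V → Fin (M.target + 1)) : ℝ :=
  ∏ v, (M.reward v (ρ v)).toReal

open Classical in
/-- The total reward of the vertices occurring in `L`; a repeated vertex counts only once. -/
def collected (ρ : V → Fin (M.target + 1)) (L : List V) : ℕ :=
  ∑ v ∈ L.toFinset, (ρ v : ℕ)

/-- A rule telling which sequence of vertices is visited under each realization is feasible if,
almost surely, it collects the target reward or it visits every vertex. -/
def Feasible (visits : (V → Fin (M.target + 1)) → List V) : Prop :=
  ∀ ρ, 0 < M.weight ρ → M.target ≤ M.collected ρ (visits ρ) ∨ ∀ v, v ∈ visits ρ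

open Classical in
/-- Expected cost, where `len L` is the cost of visiting the vertices of `L` in this order. -/
def expectedCost (len : List V → ℝ) (visits : (V → Fin (M.target + 1)) → List V) : ℝ :=
  ∑ ρ, M.weight ρ * len (visits ρ)

/-- Optimal expected cost of a (feasible) adaptive policy. -/
def adaptiveOpt (len : List V → ℝ) : ℝ :=
  sInf {x | ∃ t : DecisionTree V M.target,
    M.Feasible (fun ρ => t.visited ρ) ∧ x = M.expectedCost len (fun ρ => t.visited ρ)}

/-- Optimal expected cost of a (feasible) non-adaptive policy: a list of distinct vertices that is
followed until the target is met. -/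
def nonAdaptiveOpt (len : List V → ℝ) : ℝ :=
  sInf {x | ∃ τ : List V, τ.Nodup ∧
    M.Feasible (fun ρ => visitUntil ρ M.target τ) ∧
    x = M.expectedCost len (fun ρ => visitUntil ρ M.target τ)}

/-- The ratio of the optimal non-adaptive cost to the optimal adaptive cost of an instance. -/
def gapRatio (len : List V → ℝ) : ℝ≥0∞ :=
  ENNReal.ofReal (M.nonAdaptiveOpt len / M.adaptiveOpt len)

end RewardModel

/-- All rewards except that of at most one vertex are deterministic. -/
def RewardModel.SingleRandom {V : Type} (M : RewardModel V) : Prop :=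
  ∃ r : V, ∀ v, v ≠ r → ∃ a, M.reward v = PMF.pure a

/-- Length of the walk that starts at `u`, visits the listed vertices and ends at the depot. -/
def walkLength {V : Type} [MetricSpace V] (depot : V) : V → List V → ℝ
  | u, [] => dist u depot
  | u, v :: L => dist u v + walkLength depot v L

/-- Length of the closed tour from the depot through the listed vertices. (Visiting the depot
itself, so as to collect its reward, is free at the start.) -/
def tourLength {V : Type} [MetricSpace V] (depot : V) (L : List V) : ℝ :=
  walkLength depot depot L

/-- The metric is that of a weighted star with centre `depot`. -/
def IsWeightedStar {V : Type} [MetricSpace V] (depot : V) : Prop :=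
  ∀ u v : V, u ≠ v → dist u v = dist u depot + dist depot v

/-- The cost, in the knapsack cover problem, of the listed items. -/
def knapsackCost {V : Type} (c : V → ℝ≥0) (L : List V) : ℝ :=
  (L.map fun v => (c v : ℝ)).sum

/-- The adaptivity gap of stochastic `k`-TSP: the worst ratio over all instances. -/
def kTSPAdaptivityGap : ℝ≥0∞ :=
  ⨆ (V : Type) (_ : Fintype V) (_ : MetricSpace V) (depot : V) (M : RewardModel V),
    M.gapRatio (tourLength depot)

/-- The adaptivity gap of stochastic `k`-TSP on weighted stars rooted at the depot, with a single
random reward. -/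
def starKTSPAdaptivityGap : ℝ≥0∞ :=
  ⨆ (V : Type) (_ : Fintype V) (_ : MetricSpace V) (depot : V) (M : RewardModel V)
    (_ : IsWeightedStar depot) (_ : M.SingleRandom), M.gapRatio (tourLength depot)

/-- The adaptivity gap of stochastic knapsack cover with a single random item. -/
def knapsackCoverAdaptivityGap : ℝ≥0∞ :=
  ⨆ (V : Type) (_ : Fintype V) (c : V → ℝ≥0) (M : RewardModel V) (_ : M.SingleRandom),
    M.gapRatio (knapsackCost c)

/-- Target `2 ^ (n + 1)`. The item `none` is random, with reward `2 ^ (n + 1) - 2 ^ i` with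
probability `p_i`, `1 ≤ i ≤ n`; the other `n` items have deterministic rewards `2 ^ i`,
`1 ≤ i ≤ n`. The index `i : Fin n` stands for the number `i + 1`. -/
def biddingModel (n : ℕ) (p : PMF (Fin n)) : RewardModel (Option (Fin n)) where
  target := 2 ^ (n + 1)
  reward
    | none => p.map fun i => ⟨2 ^ (n + 1) - 2 ^ ((i : ℕ) + 1), Nat.lt_succ_of_le (Nat.sub_le _ _)⟩
    | some i => PMF.pure ⟨2 ^ ((i : ℕ) + 1),
        Nat.lt_succ_of_le (Nat.pow_le_pow_right (by norm_num) (by omega))⟩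

/-- The random item costs `0`, and the deterministic item of reward `2 ^ i` costs `i`. -/
def biddingCost (n : ℕ) : Option (Fin n) → ℝ≥0
  | none => 0
  | some i => ((i : ℕ) : ℝ≥0) + 1

end

/-! The instance encodes online bidding. If the random reward encodes threshold `i`, all items below
`i` together still miss the target, while item `i` alone closes the gap. An adaptive policy reads
the threshold for free and buys one item. A list has to bid blindly until some bid reaches the
threshold.

Let the threshold be at least `k` with probability `1 / k` for `k ≤ n`. Reading it first costs the
harmonic number `H_n` on average (`adaptiveOpt_le`). In a list, a bid `b` that follows a previous
maximum `a` is paid with probability `1 / (a + 1)`, so it costs `b / (a + 1)`. Since `x ≥ e * log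
x`, this is almost `e * (H_b - H_a)` for large `a` (`bidRatio_mul_harmonicIco_le`). Telescoping over
the record bids gives almost `e * H_n` (`bidRatio_mul_le_sum_bidCost`). Bids up to a cutoff `m` are
discarded, which is harmless because `H_n` diverges.

On a star with the random item at the centre, tours through distinct vertices cost the same as in
knapsack cover, so the bound transfers. -/

/-! ### The threshold distribution -/

/-- The probability that the threshold, as an element of `Fin n`, is at least `i`. -/
noncomputable def tailProb (n i : ℕ) : ℝ := if i < n then 1 / ((i : ℝ) + 1) else 0

/-- The probability that the threshold equals `i`. -/
noncomputable def pointProb (n i : ℕ) : ℝ := tailProb n i - tailProb n (i + 1)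

theorem tailProb_self (n : ℕ) : tailProb n n = 0 := by simp [tailProb]

theorem pointProb_pos {n i : ℕ} (h : i < n) : 0 < pointProb n i := by
  unfold pointProb tailProb
  rw [if_pos h]
  split_ifs
  · rw [sub_pos]
    apply one_div_lt_one_div_of_lt <;> push_cast <;> linarith [Nat.cast_nonneg (α := ℝ) i]
  · rw [sub_zero]; positivity

theorem sum_Ico_pointProb {n a : ℕ} (h : a ≤ n) :
    ∑ i ∈ Finset.Ico a n, pointProb n i = tailProb n a := by
  have := Finset.sum_Ico_sub (fun i => tailProb n i) h
  rw [tailProb_self] at this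
  have h2 : ∑ i ∈ Finset.Ico a n, pointProb n i
      = -∑ i ∈ Finset.Ico a n, (tailProb n (i + 1) - tailProb n i) := by
    rw [← Finset.sum_neg_distrib]
    exact Finset.sum_congr rfl fun i _ => by unfold pointProb; ring
  rw [h2, this]; ring

/-- The harmonic sum `∑ 1 / (i + 1)` over `a ≤ i < b`. -/
noncomputable def harmonicIco (a b : ℕ) : ℝ := ∑ i ∈ Finset.Ico a b, 1 / ((i : ℝ) + 1)

theorem harmonicIco_nonneg (a b : ℕ) : 0 ≤ harmonicIco a b :=
  Finset.sum_nonneg fun _ _ => by positivity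

/-- Summation by parts; the boundary term vanishes at `n`. This is the expected cost of buying
exactly the item needed. -/
theorem sum_pointProb_mul (n : ℕ) :
    ∑ i ∈ Finset.range n, pointProb n i * ((i : ℝ) + 1) = harmonicIco 0 n := by
  have key : ∀ k, ∑ i ∈ Finset.range k, pointProb n i * ((i : ℝ) + 1)
      = ∑ i ∈ Finset.range k, tailProb n i - k * tailProb n k := by
    intro k
    induction k with
    | zero => simp
    | succ k ih =>
      rw [Finset.sum_range_succ, Finset.sum_range_succ, ih]
      unfold pointProb; push_cast; ring
  rw [key, tailProb_self, mul_zero, sub_zero, harmonicIco, ← Finset.range_eq_Ico]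
  exact Finset.sum_congr rfl fun i hi => by simp [tailProb, Finset.mem_range.1 hi]

/-- The distribution of the threshold, for which the number `k ≤ n` is attained
or exceeded with probability `1 / k`. -/
noncomputable def thresholdPMF (n : ℕ) (hn : 1 ≤ n) : PMF (Fin n) :=
  PMF.ofFintype (fun i => ENNReal.ofReal (pointProb n i)) (by
    rw [← ENNReal.ofReal_sum_of_nonneg fun i _ => (pointProb_pos i.2).le,
      Fin.sum_univ_eq_sum_range (fun i => pointProb n i), Finset.range_eq_Ico,
      sum_Ico_pointProb (Nat.zero_le n)]
    simp [tailProb, Nat.pos_of_ne_zero (Nat.one_le_iff_ne_zero.1 hn)])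

theorem thresholdPMF_toReal (n : ℕ) (hn : 1 ≤ n) (i : Fin n) :
    (thresholdPMF n hn i).toReal = pointProb n i := by
  simp [thresholdPMF, ENNReal.toReal_ofReal (pointProb_pos i.2).le]

/-! ### Harmonic sums against logarithms -/

theorem harmonicIco_le {a b : ℕ} (h : a < b) :
    harmonicIco a b ≤ 1 / ((a : ℝ) + 1) + Real.log ((b : ℝ) / (a + 1)) := by
  induction b, h using Nat.le_induction with
  | base =>
    have : ((a : ℝ) + 1) / (a + 1) = 1 := div_self (by positivity)
    simp [harmonicIco, this]
  | succ b hab ih =>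
    have hb : (0 : ℝ) < b := by exact_mod_cast (by omega : 0 < b)
    rw [harmonicIco, Finset.sum_Ico_succ_top (by omega), ← harmonicIco]
    have h1 : Real.log ((b : ℝ) / (b + 1)) ≤ (b : ℝ) / (b + 1) - 1 :=
      Real.log_le_sub_one_of_pos (by positivity)
    have h2 : (b : ℝ) / (b + 1) - 1 = -(1 / ((b : ℝ) + 1)) := by field_simp; ring
    have h3 : Real.log ((b : ℝ) / (a + 1)) = Real.log (((b + 1 : ℕ) : ℝ) / (a + 1))
        + Real.log ((b : ℝ) / (b + 1)) := by
      rw [← Real.log_mul (by positivity) (by positivity)]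
      congr 1; push_cast; field_simp
    linarith

/-- Tangent line of `exp` at `0`, taken at `log x - 1`. Equality at `x = e` is where the constant
comes from. -/
theorem exp_one_mul_log_le {x : ℝ} (hx : 0 < x) : Real.exp 1 * Real.log x ≤ x := by
  have h := Real.add_one_le_exp (Real.log x - 1)
  rw [Real.exp_sub, Real.exp_log hx, le_div_iff₀ (Real.exp_pos 1)] at h
  linarith

/-- The competitive ratio forced by thresholds larger than `m`. -/
noncomputable def bidRatio (m : ℕ) : ℝ := Real.exp 1 / (1 + Real.exp 1 / m)

theorem bidRatio_nonneg (m : ℕ) : 0 ≤ bidRatio m := by unfold bidRatio; positivity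

/-- The right side is the expected cost of one record bid. As it is at least `1`, the error `e / m`
from the first harmonic term is absorbed into the factor `1 + e / m`. -/
theorem bidRatio_mul_harmonicIco_le {m a b : ℕ} (hm : 1 ≤ m) (hma : m ≤ a) (hab : a < b) :
    bidRatio m * harmonicIco a b ≤ (b : ℝ) / (a + 1) := by
  have hm' : (0 : ℝ) < m := by exact_mod_cast hm
  have hma' : (m : ℝ) ≤ a := by exact_mod_cast hma
  have hab' : (a : ℝ) + 1 ≤ b := by exact_mod_cast hab
  have hx : 1 ≤ (b : ℝ) / (a + 1) := by rwa [one_le_div (by positivity)]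
  have h1 := harmonicIco_le hab
  have h2 := exp_one_mul_log_le (lt_of_lt_of_le one_pos hx)
  have h3 : 1 / ((a : ℝ) + 1) ≤ 1 / m := one_div_le_one_div_of_le hm' (by linarith)
  have he := Real.exp_pos 1
  have h4 : Real.exp 1 / m ≤ (b : ℝ) / (a + 1) * (Real.exp 1 / m) :=
    le_mul_of_one_le_left (by positivity) hx
  unfold bidRatio
  rw [div_mul_eq_mul_div, div_le_iff₀ (by positivity)]
  calc Real.exp 1 * harmonicIco a b
      ≤ Real.exp 1 * (1 / (m : ℝ) + Real.log ((b : ℝ) / (a + 1))) := by gcongr; linarith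
    _ = Real.exp 1 / m + Real.exp 1 * Real.log ((b : ℝ) / (a + 1)) := by ring
    _ ≤ _ := by linarith

theorem tendsto_bidRatio : Tendsto bidRatio atTop (𝓝 (Real.exp 1)) := by
  have h : Tendsto (fun m : ℕ => Real.exp 1 / (1 + Real.exp 1 / (m : ℝ))) atTop
      (𝓝 (Real.exp 1 / (1 + 0))) :=
    tendsto_const_nhds.div (tendsto_const_nhds.add (tendsto_const_div_atTop_nhds_zero_nat _))
      (by norm_num)
  rw [add_zero, div_one] at h
  exact h

/-! ### Lower bound for online bidding -/

/-- The cost of bidding `j + 1` for the entries `j` of a list, up to the first `j ≥ i`. -/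
noncomputable def bidCost {n : ℕ} (i : ℕ) : List (Fin n) → ℝ
  | [] => 0
  | j :: L => ((j : ℕ) : ℝ) + 1 + if i ≤ j then 0 else bidCost i L

theorem bidCost_nonneg {n : ℕ} (i : ℕ) (L : List (Fin n)) : 0 ≤ bidCost i L := by
  induction L with
  | nil => exact le_rfl
  | cons j L ih => unfold bidCost; split_ifs <;> positivity

/-- Induction along the list, where `a` is the highest bid so far and only thresholds with index at
least `a` remain unmet. The hypothesis `h` excludes lists that are cheap because they never reach
the top. -/
theorem bidRatio_mul_le_sum_bidCost {n m : ℕ} (hm : 1 ≤ m) (L : List (Fin n)) (a : ℕ)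
    (h : n ≤ a ∨ ∃ l ∈ L, (l : ℕ) + 1 = n) :
    bidRatio m * harmonicIco (max a m) n ≤
      ∑ i ∈ Finset.Ico a n, pointProb n i * bidCost i L := by
  have nonneg : ∀ (a : ℕ) (L : List (Fin n)),
      0 ≤ ∑ i ∈ Finset.Ico a n, pointProb n i * bidCost i L := fun a L =>
    Finset.sum_nonneg fun i hi =>
      mul_nonneg (pointProb_pos (Finset.mem_Ico.1 hi).2).le (bidCost_nonneg _ _)
  have trivial_case : ∀ (a : ℕ) (L : List (Fin n)), n ≤ max a m →
      bidRatio m * harmonicIco (max a m) n ≤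
        ∑ i ∈ Finset.Ico a n, pointProb n i * bidCost i L := fun a L h => by
    rw [harmonicIco, Finset.Ico_eq_empty_of_le h]; simpa using nonneg a L
  induction L generalizing a with
  | nil =>
    rcases h with h | ⟨l, hl, -⟩
    · exact trivial_case a [] (h.trans (le_max_left _ _))
    · simp at hl
  | cons j L ih =>
    by_cases hn : n ≤ max a m
    · exact trivial_case a _ hn
    push Not at hn
    obtain ⟨han, hmn⟩ := max_lt_iff.1 hn
    obtain ⟨l, hl, hln⟩ := h.resolve_left (by omega)
    -- A bid below the current record meets no remaining threshold and only adds cost.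
    by_cases hja : (j : ℕ) < a
    · have hlL : l ∈ L := by
        rcases List.mem_cons.1 hl with rfl | h'
        · omega
        · exact h'
      refine (ih a (Or.inr ⟨l, hlL, hln⟩)).trans (Finset.sum_le_sum fun i hi => ?_)
      obtain ⟨hai, hin⟩ := Finset.mem_Ico.1 hi
      refine mul_le_mul_of_nonneg_left ?_ (pointProb_pos hin).le
      rw [bidCost, if_neg (by omega)]
      linarith [Nat.cast_nonneg (α := ℝ) (j : ℕ)]
    · push Not at hja
      have hjn := j.2
      have IH := ih (j + 1) (by
        rcases List.mem_cons.1 hl with rfl | h'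
        · exact Or.inl hln.ge
        · exact Or.inr ⟨l, h', hln⟩)
      -- All remaining thresholds pay for bid `j`; only those above `j` pay for the rest of the
      -- list.
      have hsplit : ∑ i ∈ Finset.Ico a n, pointProb n i * bidCost i (j :: L)
          = ((j : ℝ) + 1) * tailProb n a
            + ∑ i ∈ Finset.Ico ((j : ℕ) + 1) n, pointProb n i * bidCost i L := by
        rw [← sum_Ico_pointProb han.le, Finset.mul_sum,
          ← Finset.sum_Ico_consecutive (fun i => pointProb n i * bidCost i (j :: L))
            (show a ≤ (j : ℕ) + 1 by omega) hjn,
          ← Finset.sum_Ico_consecutive (fun i => ((j : ℝ) + 1) * pointProb n i)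
            (show a ≤ (j : ℕ) + 1 by omega) hjn, add_assoc, ← Finset.sum_add_distrib]
        congr 1
        · refine Finset.sum_congr rfl fun i hi => ?_
          rw [bidCost, if_pos (by have := Finset.mem_Ico.1 hi; omega)]; ring
        · refine Finset.sum_congr rfl fun i hi => ?_
          rw [bidCost, if_neg (by have := Finset.mem_Ico.1 hi; omega)]; ring
      rw [hsplit, tailProb, if_pos han]
      have hpos : (0 : ℝ) ≤ ((j : ℝ) + 1) * (1 / ((a : ℝ) + 1)) := by positivity
      -- Up to the cutoff `m` the bid is dropped; beyond it, its cost pays for a new stretch of the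
      -- harmonic sum.
      by_cases hjm : (j : ℕ) + 1 ≤ m
      · rw [max_eq_right hjm] at IH
        rw [max_eq_right (by omega)]
        linarith
      · push Not at hjm
        rw [max_eq_left hjm.le] at IH
        have hcons : harmonicIco (max a m) n
            = harmonicIco (max a m) ((j : ℕ) + 1) + harmonicIco ((j : ℕ) + 1) n :=
          (Finset.sum_Ico_consecutive _ (by omega) hjn).symm
        have key := bidRatio_mul_harmonicIco_le hm (le_max_right a m)
          (show max a m < (j : ℕ) + 1 by omega)
        have hle : (((j : ℕ) + 1 : ℕ) : ℝ) / (((max a m : ℕ) : ℝ) + 1)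
            ≤ ((j : ℝ) + 1) * (1 / ((a : ℝ) + 1)) := by
          rw [mul_one_div]; push_cast
          gcongr
          exact le_max_left _ _
        rw [hcons, mul_add]
        linarith

/-! ### Feasibility of list policies -/

theorem visitUntil_sublist {V : Type} {k : ℕ} (ρ : V → Fin (k + 1)) (m : ℕ) (τ : List V) :
    (visitUntil ρ m τ).Sublist τ := by
  induction τ generalizing m with
  | nil => exact List.Sublist.refl _
  | cons v τ ih =>
    unfold visitUntil
    split_ifs
    · exact List.nil_sublist _
    · exact (ih _).cons_cons v

theorem le_sum_visitUntil_or_eq {V : Type} {k : ℕ} (ρ : V → Fin (k + 1)) (m : ℕ) (τ : List V) :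
    m ≤ ((visitUntil ρ m τ).map fun v => (ρ v : ℕ)).sum ∨ visitUntil ρ m τ = τ := by
  induction τ generalizing m with
  | nil => exact Or.inr rfl
  | cons v τ ih =>
    unfold visitUntil
    split_ifs with h
    · exact Or.inl (by simp [h])
    · rcases ih (m - (ρ v : ℕ)) with h | h
      · left; simp only [List.map_cons, List.sum_cons]; omega
      · right; rw [h]

theorem RewardModel.collected_eq_sum {V : Type} (M : RewardModel V)
    (ρ : V → Fin (M.target + 1)) {L : List V} (h : L.Nodup) :
    M.collected ρ L = (L.map fun v => (ρ v : ℕ)).sum := by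
  classical
  unfold RewardModel.collected
  rw [← List.sum_toFinset _ h]

theorem RewardModel.feasible_visitUntil {V : Type} [Fintype V] (M : RewardModel V) {τ : List V}
    (hτ : τ.Nodup) (hall : ∀ v, v ∈ τ) : M.Feasible (fun ρ => visitUntil ρ M.target τ) := by
  intro ρ _
  rw [M.collected_eq_sum ρ (hτ.sublist (visitUntil_sublist ρ _ τ))]
  rcases le_sum_visitUntil_or_eq ρ M.target τ with h | h
  · exact Or.inl h
  · exact Or.inr fun v => (congrArg (v ∈ ·) h).mpr (hall v)

/-! ### Reduction of the instance to a sum over thresholds -/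

/-- The reward of the random item of `biddingModel` under threshold `i`. -/
def thresholdReward (n : ℕ) (i : Fin n) : Fin (2 ^ (n + 1) + 1) :=
  ⟨2 ^ (n + 1) - 2 ^ ((i : ℕ) + 1), Nat.lt_succ_of_le (Nat.sub_le _ _)⟩

/-- The realization of the rewards of `biddingModel` under threshold `i`. -/
def biddingRewards (n : ℕ) (i : Fin n) : Option (Fin n) → Fin (2 ^ (n + 1) + 1)
  | none => thresholdReward n i
  | some j => ⟨2 ^ ((j : ℕ) + 1),
      Nat.lt_succ_of_le (Nat.pow_le_pow_right (by norm_num) (by omega))⟩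

theorem thresholdReward_injective (n : ℕ) : Function.Injective (thresholdReward n) := by
  intro i j h
  have h' : 2 ^ (n + 1) - 2 ^ ((i : ℕ) + 1) = 2 ^ (n + 1) - 2 ^ ((j : ℕ) + 1) :=
    congrArg Fin.val h
  have hi : 2 ^ ((i : ℕ) + 1) ≤ 2 ^ (n + 1) := Nat.pow_le_pow_right (by norm_num) (by omega)
  have hj : 2 ^ ((j : ℕ) + 1) ≤ 2 ^ (n + 1) := Nat.pow_le_pow_right (by norm_num) (by omega)
  have := Nat.pow_right_injective (le_refl 2) (show 2 ^ ((i : ℕ) + 1) = 2 ^ ((j : ℕ) + 1) by omega)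
  exact Fin.ext (by omega)

open Classical in
-- Deterministic items fix every coordinate except `none`, so the product measure lives on the `n`
-- realizations `biddingRewards n i`.
theorem biddingModel_weight (n : ℕ) (p : PMF (Fin n))
    (ρ : Option (Fin n) → Fin (2 ^ (n + 1) + 1)) :
    (biddingModel n p).weight ρ = ∑ i, (p i).toReal * if ρ = biddingRewards n i then 1 else 0 := by
  have h1 : (biddingModel n p).weight ρ = (p.map (thresholdReward n) (ρ none)).toReal *
      ∏ j : Fin n, ((PMF.pure (biddingRewards n j (some j))) (ρ (some j))).toReal :=
    (Fintype.prod_option fun v => ((biddingModel n p).reward v (ρ v)).toReal).trans (by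
      congr 1
      -- In `biddingModel` the map is applied to the push-forward of `p` to `ℕ`; composing the maps
      -- returns to `Fin n`.
      have h0 : (biddingModel n p).reward none = p.map (thresholdReward n) := by
        have hp : (p >>= fun a => pure (a : ℕ) : PMF ℕ) = p.map Fin.val := rfl
        simp only [biddingModel]
        rw [hp, PMF.map_comp]
        rfl
      exact congrArg (fun q : PMF (Fin (2 ^ (n + 1) + 1)) => (q (ρ none)).toReal) h0)
  rw [h1, PMF.map_apply, tsum_fintype, ENNReal.toReal_sum fun i _ => by
    split_ifs
    · exact p.apply_ne_top i
    · simp, Finset.sum_mul]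
  refine Finset.sum_congr rfl fun i _ => ?_
  simp only [PMF.pure_apply]
  by_cases h : ρ = biddingRewards n i
  · subst h
    rw [if_pos rfl, if_pos (by rfl), Finset.prod_eq_one]
    intro j _
    rw [if_pos (by rfl)]; rfl
  · rw [if_neg h, mul_zero]
    by_cases h0 : ρ none = thresholdReward n i
    · have : ∃ j : Fin n, ρ (some j) ≠ biddingRewards n j (some j) := by
        by_contra! hc
        refine h (funext fun v => ?_)
        cases v with
        | none => exact h0
        | some j => exact hc j
      obtain ⟨j, hj⟩ := this
      rw [Finset.prod_eq_zero (Finset.mem_univ j) (by rw [if_neg hj]; rfl), mul_zero]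
    · rw [if_neg h0]; simp

/-- Exchanges the classical decidability behind the finite type of realizations for the ambient
instance. -/
theorem RewardModel.expectedCost_eq_sum {V : Type} [Fintype V] [DecidableEq V] (M : RewardModel V)
    (len : List V → ℝ) (visits : (V → Fin (M.target + 1)) → List V) :
    M.expectedCost len visits = ∑ ρ, M.weight ρ * len (visits ρ) := by
  unfold RewardModel.expectedCost
  congr!

theorem biddingModel_expectedCost (n : ℕ) (p : PMF (Fin n)) (len : List (Option (Fin n)) → ℝ)
    (visits : (Option (Fin n) → Fin (2 ^ (n + 1) + 1)) → List (Option (Fin n))) :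
    (biddingModel n p).expectedCost len visits
      = ∑ i, (p i).toReal * len (visits (biddingRewards n i)) := by
  classical
  have h : (biddingModel n p).expectedCost len visits
      = ∑ ρ : Option (Fin n) → Fin (2 ^ (n + 1) + 1),
          (biddingModel n p).weight ρ * len (visits ρ) :=
    (biddingModel n p).expectedCost_eq_sum len visits
  rw [h]
  simp_rw [biddingModel_weight, Finset.sum_mul]
  rw [Finset.sum_comm]
  refine Finset.sum_congr rfl fun i _ => ?_
  rw [Finset.sum_eq_single (biddingRewards n i)]
  · simp
  · intro ρ _ hρ; simp [hρ]
  · simp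

theorem biddingModel_weight_pos {n : ℕ} {p : PMF (Fin n)} (i : Fin n) (hi : 0 < (p i).toReal) :
    0 < (biddingModel n p).weight (biddingRewards n i) := by
  classical
  rw [biddingModel_weight]
  refine Finset.sum_pos' (fun j _ => by positivity) ⟨i, Finset.mem_univ i, by simpa using hi⟩

theorem exists_eq_of_biddingModel_weight_pos {n : ℕ} {p : PMF (Fin n)}
    {ρ : Option (Fin n) → Fin (2 ^ (n + 1) + 1)} (h : 0 < (biddingModel n p).weight ρ) :
    ∃ i, ρ = biddingRewards n i := by
  classical
  rw [biddingModel_weight] at h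
  by_contra! hc
  simp [hc] at h

/-! ### From list policies to bidding -/

/-- The rewards under threshold `i`, except that items which meet the threshold are void. -/
def insufficientReward (n : ℕ) (i : Fin n) : Option (Fin n) → ℕ
  | none => 2 ^ (n + 1) - 2 ^ ((i : ℕ) + 1)
  | some j => if (j : ℕ) < i then 2 ^ ((j : ℕ) + 1) else 0

/-- The powers `2, …, 2 ^ i` sum to `2 ^ (i + 1) - 2`, two short of what the random reward leaves
open. -/
theorem sum_insufficientReward_lt (n : ℕ) (i : Fin n) :
    ∑ v, insufficientReward n i v < 2 ^ (n + 1) := by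
  rw [Fintype.sum_option]
  have h1 : ∑ j : Fin n, insufficientReward n i (some j)
      = ∑ j ∈ Finset.range i, 2 ^ (j + 1) := by
    simp only [insufficientReward]
    rw [Fin.sum_univ_eq_sum_range (fun j => if j < (i : ℕ) then 2 ^ (j + 1) else 0),
      ← Finset.sum_filter]
    congr 1
    ext j
    have := i.2
    simp only [Finset.mem_filter, Finset.mem_range]
    omega
  have h2 : ∀ k, ∑ j ∈ Finset.range k, 2 ^ (j + 1) + 2 = 2 ^ (k + 1) := by
    intro k
    induction k with
    | zero => rfl
    | succ k ih => rw [Finset.sum_range_succ, pow_succ 2 (k + 1)]; omega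
  have h3 : 2 ^ ((i : ℕ) + 1) ≤ 2 ^ (n + 1) := Nat.pow_le_pow_right (by norm_num) (by omega)
  have := h2 i
  rw [h1, insufficientReward]
  omega

theorem knapsackCost_nonneg {V : Type} (c : V → ℝ≥0) (L : List V) : 0 ≤ knapsackCost c L :=
  List.sum_nonneg fun x hx => by
    obtain ⟨v, -, rfl⟩ := List.mem_map.1 hx
    exact (c v).2

theorem knapsackCost_cons {V : Type} (c : V → ℝ≥0) (v : V) (L : List V) :
    knapsackCost c (v :: L) = c v + knapsackCost c L := by simp [knapsackCost]

/-- By `hm` the policy cannot stop before an item that meets the threshold. The random item is free,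
so its position is irrelevant and `filterMap id` deletes it. -/
theorem bidCost_le_knapsackCost {n : ℕ} (i : Fin n) (τ : List (Option (Fin n))) (m : ℕ)
    (hm : (τ.map (insufficientReward n i)).sum < m) :
    bidCost i (τ.filterMap id) ≤
      knapsackCost (biddingCost n) (visitUntil (biddingRewards n i) m τ) := by
  induction τ generalizing m with
  | nil => simp [bidCost, visitUntil, knapsackCost]
  | cons v τ ih =>
    simp only [List.map_cons, List.sum_cons] at hm
    rw [visitUntil, if_neg (by omega), knapsackCost_cons]
    cases v with
    | none =>
      have : insufficientReward n i none = (biddingRewards n i none : ℕ) := rfl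
      simpa [biddingCost] using ih _ (by omega)
    | some j =>
      have hc : ((biddingCost n (some j) : ℝ≥0) : ℝ) = (j : ℝ) + 1 := by simp [biddingCost]
      have hf : (some j :: τ).filterMap id = j :: τ.filterMap id := by simp
      rw [hc, hf, bidCost]
      split_ifs with hij
      · linarith [knapsackCost_nonneg (biddingCost n)
          (visitUntil (biddingRewards n i) (m - (biddingRewards n i (some j) : ℕ)) τ)]
      · have : insufficientReward n i (some j) = (biddingRewards n i (some j) : ℕ) := by
          simp [insufficientReward, biddingRewards, Nat.lt_of_not_le hij]
        linarith [ih (m - (biddingRewards n i (some j) : ℕ)) (by omega)]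

/-- A feasible set of items has one that meets the threshold. -/
theorem exists_mem_of_feasible {n : ℕ} {p : PMF (Fin n)} (i : Fin n)
    {L : List (Option (Fin n))}
    (h : (biddingModel n p).target ≤ (biddingModel n p).collected (biddingRewards n i) L ∨
      ∀ v, v ∈ L) : ∃ j, i ≤ j ∧ some j ∈ L := by
  classical
  rcases h with h | h
  · by_contra! hc
    have h1 : (biddingModel n p).collected (biddingRewards n i) L
        ≤ ∑ v, insufficientReward n i v := by
      unfold RewardModel.collected
      refine le_trans (Finset.sum_le_sum fun v hv => ?_)
        (Finset.sum_le_sum_of_subset (Finset.subset_univ _))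
      cases v with
      | none => exact le_rfl
      | some j =>
        have hj : (j : ℕ) < i := by
          by_contra hij
          exact hc j (by simpa using hij) (by simpa using hv)
        simp [insufficientReward, biddingRewards, hj]
    have h2 : (biddingModel n p).target = 2 ^ (n + 1) := rfl
    have := sum_insufficientReward_lt n i
    omega
  · exact ⟨i, le_rfl, h _⟩

/-! ### Bounds on the two optima -/

/-- A policy that learns the threshold first and then buys the item that just meets it. -/
noncomputable def learnFirst (n : ℕ) [Nonempty (Fin n)] : DecisionTree (Option (Fin n)) (2 ^ (n + 1)) :=
  .visit none fun x => .visit (some (Function.invFun (thresholdReward n) x)) fun _ => .halt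

theorem learnFirst_visited (n : ℕ) [Nonempty (Fin n)] (i : Fin n) :
    (learnFirst n).visited (biddingRewards n i) = [none, some i] := by
  have : Function.invFun (thresholdReward n) (biddingRewards n i none) = i :=
    Function.leftInverse_invFun (thresholdReward_injective n) i
  simp only [learnFirst, DecisionTree.visited, this]

theorem learnFirst_feasible (n : ℕ) [Nonempty (Fin n)] (p : PMF (Fin n)) :
    (biddingModel n p).Feasible (fun ρ => (learnFirst n).visited ρ) := by
  intro ρ hρ
  obtain ⟨i, rfl⟩ := exists_eq_of_biddingModel_weight_pos hρ
  left
  change 2 ^ (n + 1) ≤ (biddingModel n p).collected (biddingRewards n i)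
    ((learnFirst n).visited (biddingRewards n i))
  rw [learnFirst_visited]
  refine le_of_le_of_eq ?_ ((biddingModel n p).collected_eq_sum _ (by simp)).symm
  have hi : 2 ^ ((i : ℕ) + 1) ≤ 2 ^ (n + 1) := Nat.pow_le_pow_right (by norm_num) (by omega)
  simp only [List.map_cons, List.map_nil, List.sum_cons, List.sum_nil, biddingRewards,
    thresholdReward]
  omega

section Bounds

variable {n : ℕ} (hn : 1 ≤ n) {len : List (Option (Fin n)) → ℝ}

/-- An abstract `len` serves both knapsack cost and star tours. Those agree on duplicate-free lists
only, and a tree may revisit vertices, so this crude bound relies on `hpos` alone. -/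
theorem one_le_adaptive_expectedCost (hpos : ∀ j L, some j ∈ L → 1 ≤ len L)
    (t : DecisionTree (Option (Fin n)) (2 ^ (n + 1)))
    (ht : (biddingModel n (thresholdPMF n hn)).Feasible (fun ρ => t.visited ρ)) :
    1 ≤ (biddingModel n (thresholdPMF n hn)).expectedCost len (fun ρ => t.visited ρ) := by
  refine le_of_le_of_eq ?_ (biddingModel_expectedCost n _ len fun ρ => t.visited ρ).symm
  have hsum : ∑ i : Fin n, pointProb n i = 1 := by
    rw [Fin.sum_univ_eq_sum_range (fun i => pointProb n i), Finset.range_eq_Ico,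
      sum_Ico_pointProb (Nat.zero_le n)]
    simp [tailProb, Nat.pos_of_ne_zero (Nat.one_le_iff_ne_zero.1 hn)]
  rw [← hsum]
  refine Finset.sum_le_sum fun i _ => ?_
  have hi := pointProb_pos i.2
  rw [thresholdPMF_toReal]
  obtain ⟨j, -, hj⟩ := exists_mem_of_feasible i
    (ht _ (biddingModel_weight_pos i (by rwa [thresholdPMF_toReal])))
  exact le_mul_of_one_le_right hi.le (hpos j _ hj)

theorem adaptiveOpt_pos (hpos : ∀ j L, some j ∈ L → 1 ≤ len L) :
    0 < (biddingModel n (thresholdPMF n hn)).adaptiveOpt len := by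
  have : Nonempty (Fin n) := ⟨⟨0, hn⟩⟩
  refine lt_of_lt_of_le one_pos (le_csInf ⟨_, learnFirst n, learnFirst_feasible n _, rfl⟩ ?_)
  rintro x ⟨t, ht, rfl⟩
  exact one_le_adaptive_expectedCost hn hpos t ht

theorem adaptiveOpt_le (hpos : ∀ j L, some j ∈ L → 1 ≤ len L)
    (hlen : ∀ L, L.Nodup → len L = knapsackCost (biddingCost n) L) :
    (biddingModel n (thresholdPMF n hn)).adaptiveOpt len ≤ harmonicIco 0 n := by
  have : Nonempty (Fin n) := ⟨⟨0, hn⟩⟩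
  refine csInf_le ⟨1, ?_⟩ ⟨learnFirst n, learnFirst_feasible n _, ?_⟩
  · rintro x ⟨t, ht, rfl⟩
    exact one_le_adaptive_expectedCost hn hpos t ht
  · refine Eq.trans ?_
      (biddingModel_expectedCost n _ len fun ρ => (learnFirst n).visited ρ).symm
    rw [← sum_pointProb_mul,
      ← Fin.sum_univ_eq_sum_range (fun i => pointProb n i * ((i : ℝ) + 1))]
    refine Finset.sum_congr rfl fun i _ => ?_
    rw [learnFirst_visited, thresholdPMF_toReal, hlen _ (by simp)]
    simp [knapsackCost, biddingCost]

theorem le_nonAdaptiveOpt (hlen : ∀ L, L.Nodup → len L = knapsackCost (biddingCost n) L)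
    {m : ℕ} (hm : 1 ≤ m) :
    bidRatio m * harmonicIco m n ≤
      (biddingModel n (thresholdPMF n hn)).nonAdaptiveOpt len := by
  -- A feasible list must exist, since `sInf ∅ = 0` in `ℝ`.
  refine le_csInf ⟨_, Finset.univ.toList, Finset.nodup_toList _,
    RewardModel.feasible_visitUntil _ (Finset.nodup_toList _) (by simp), rfl⟩ ?_
  rintro x ⟨τ, hτ, hfeas, rfl⟩
  refine le_of_le_of_eq ?_
    (biddingModel_expectedCost n _ len fun ρ => visitUntil ρ (2 ^ (n + 1)) τ).symm
  -- The top threshold has positive probability, so feasibility forces the top item into the list.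
  have hlast : ∃ l ∈ τ.filterMap id, (l : ℕ) + 1 = n := by
    have hn' : n - 1 < n := by omega
    obtain ⟨j, hj, hmem⟩ := exists_mem_of_feasible ⟨n - 1, hn'⟩
      (hfeas _ (biddingModel_weight_pos ⟨n - 1, hn'⟩
        (by rw [thresholdPMF_toReal]; exact pointProb_pos hn')))
    have hj' : n - 1 ≤ (j : ℕ) := hj
    exact ⟨j, by simpa using (visitUntil_sublist _ _ τ).subset hmem, by omega⟩
  have h := bidRatio_mul_le_sum_bidCost hm (τ.filterMap id) 0 (Or.inr hlast)
  rw [Nat.zero_max, ← Finset.range_eq_Ico,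
    ← Fin.sum_univ_eq_sum_range (fun i => pointProb n i * bidCost i (τ.filterMap id))] at h
  refine h.trans (Finset.sum_le_sum fun i _ => ?_)
  rw [thresholdPMF_toReal, hlen _ (hτ.sublist (visitUntil_sublist _ _ τ))]
  refine mul_le_mul_of_nonneg_left (bidCost_le_knapsackCost i τ _ ?_) (pointProb_pos i.2).le
  rw [← List.sum_toFinset _ hτ]
  exact (Finset.sum_le_sum_of_subset (Finset.subset_univ _)).trans_lt
    (sum_insufficientReward_lt n i)

end Bounds

/-! ### Convergence of the ratio -/

theorem tendsto_harmonicIco : Tendsto (fun n => harmonicIco 0 n) atTop atTop := by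
  simpa [harmonicIco, ← Finset.range_eq_Ico] using Real.tendsto_sum_range_one_div_nat_succ_atTop

theorem harmonicIco_le_harmonicIco_zero (m n : ℕ) : harmonicIco m n ≤ harmonicIco 0 n :=
  Finset.sum_le_sum_of_subset_of_nonneg (Finset.Ico_subset_Ico_left (Nat.zero_le m))
    fun _ _ _ => by positivity

theorem bidRatio_le (m : ℕ) : bidRatio m ≤ Real.exp 1 :=
  div_le_self (Real.exp_pos 1).le (by linarith [show 0 ≤ Real.exp 1 / m by positivity])

/-- The guaranteed ratio of the optimal costs when only thresholds larger than `m + 1` count. -/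
noncomputable def truncatedRatio (n m : ℕ) : ℝ :=
  bidRatio (m + 1) * harmonicIco (m + 1) n / harmonicIco 0 n

theorem truncatedRatio_nonneg (n m : ℕ) : 0 ≤ truncatedRatio n m :=
  div_nonneg (mul_nonneg (bidRatio_nonneg _) (harmonicIco_nonneg _ _)) (harmonicIco_nonneg _ _)

theorem truncatedRatio_le (n m : ℕ) : truncatedRatio n m ≤ Real.exp 1 :=
  div_le_of_le_mul₀ (harmonicIco_nonneg _ _) (Real.exp_pos 1).le
    (mul_le_mul (bidRatio_le _) (harmonicIco_le_harmonicIco_zero _ _) (harmonicIco_nonneg _ _)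
      (Real.exp_pos 1).le)

theorem bddAbove_truncatedRatio (n : ℕ) : BddAbove (Set.range (truncatedRatio n)) :=
  ⟨Real.exp 1, by rintro _ ⟨m, rfl⟩; exact truncatedRatio_le n m⟩

theorem tendsto_truncatedRatio (m : ℕ) :
    Tendsto (fun n => truncatedRatio n m) atTop (𝓝 (bidRatio (m + 1))) := by
  have h : Tendsto (fun n => bidRatio (m + 1) * (1 - harmonicIco 0 (m + 1) / harmonicIco 0 n))
      atTop (𝓝 (bidRatio (m + 1) * (1 - 0))) :=
    tendsto_const_nhds.mul (tendsto_const_nhds.sub (tendsto_harmonicIco.const_div_atTop _))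
  rw [sub_zero, mul_one] at h
  refine h.congr' ?_
  filter_upwards [eventually_ge_atTop (m + 1), tendsto_harmonicIco.eventually_gt_atTop 0]
    with n hn hpos
  have hsplit : harmonicIco 0 n = harmonicIco 0 (m + 1) + harmonicIco (m + 1) n :=
    (Finset.sum_Ico_consecutive _ (Nat.zero_le _) hn).symm
  rw [truncatedRatio, one_sub_div hpos.ne', mul_div_assoc]
  congr 2
  linarith

/-- The supremum lets the cutoff grow with `n` without fixing a rate: every `m` gives a lower bound
in the limit, and `e` bounds all ratios. -/
theorem tendsto_iSup_truncatedRatio :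
    Tendsto (fun n => ⨆ m, truncatedRatio n m) atTop (𝓝 (Real.exp 1)) := by
  refine tendsto_order.2 ⟨fun x hx => ?_, fun x hx => Eventually.of_forall fun n =>
    (ciSup_le (truncatedRatio_le n)).trans_lt hx⟩
  obtain ⟨m, hm⟩ := ((tendsto_bidRatio.comp (tendsto_add_atTop_nat 1)).eventually_const_lt hx).exists
  filter_upwards [(tendsto_truncatedRatio m).eventually_const_lt hm] with n h
  exact h.trans_le (le_ciSup (bddAbove_truncatedRatio n) m)

theorem iSup_truncatedRatio_mul_adaptiveOpt_le {n : ℕ} (hn : 1 ≤ n)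
    {len : List (Option (Fin n)) → ℝ} (hpos : ∀ j L, some j ∈ L → 1 ≤ len L)
    (hlen : ∀ L, L.Nodup → len L = knapsackCost (biddingCost n) L) :
    (⨆ m, truncatedRatio n m) * (biddingModel n (thresholdPMF n hn)).adaptiveOpt len ≤
      (biddingModel n (thresholdPMF n hn)).nonAdaptiveOpt len := by
  have h0 := adaptiveOpt_pos hn hpos
  have h1 := adaptiveOpt_le hn hpos hlen
  rw [← le_div_iff₀ h0]
  refine ciSup_le fun m => ?_
  rw [le_div_iff₀ h0]
  calc _ ≤ truncatedRatio n m * harmonicIco 0 n := by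
        gcongr; exact truncatedRatio_nonneg n m
    _ = bidRatio (m + 1) * harmonicIco (m + 1) n := div_mul_cancel₀ _ (h0.trans_le h1).ne'
    _ ≤ _ := le_nonAdaptiveOpt hn hlen (Nat.le_add_left 1 m)

/-! ### Transfer to the star metric -/

/-- The weighted star on the items, with the random item at the centre, in which item `i` is at
distance `i / 2` from the centre. -/
@[reducible]
noncomputable def starMetric (n : ℕ) : MetricSpace (Option (Fin n)) where
  dist u v := if u = v then 0 else ((biddingCost n u : ℝ) + biddingCost n v) / 2
  dist_self u := if_pos rfl
  dist_comm u v := by simp only [eq_comm (a := u), add_comm]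
  dist_triangle u v w := by
    have hu := (biddingCost n u).2
    have hv := (biddingCost n v).2
    have hw := (biddingCost n w).2
    simp only [NNReal.val_eq_coe] at hu hv hw
    by_cases h1 : u = v
    · subst h1; simp
    by_cases h2 : v = w
    · subst h2; simp
    rw [if_neg h1, if_neg h2]
    split_ifs <;> linarith
  eq_of_dist_eq_zero {u v} h := by
    by_contra huv
    simp only [if_neg huv] at h
    cases u <;> cases v <;> simp [biddingCost] at h huv <;> norm_cast at h

theorem isWeightedStar_starMetric (n : ℕ) :
    @IsWeightedStar _ (starMetric n) (none : Option (Fin n)) := by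
  intro u v huv
  change (if u = v then (0 : ℝ) else _) = (if u = none then (0 : ℝ) else _)
    + (if none = v then (0 : ℝ) else _)
  rw [if_neg huv]
  have h0 : (biddingCost n none : ℝ) = 0 := rfl
  split_ifs with h1 h2 h2
  · exact absurd (h1.trans h2) huv
  · rw [h1, h0]; ring
  · rw [← h2, h0]; ring
  · rw [h0]; ring

theorem dist_add_dist_le_walkLength {V : Type} [MetricSpace V] (depot u v : V) {L : List V}
    (h : v ∈ L) : dist u v + dist v depot ≤ walkLength depot u L := by
  have key : ∀ (L : List V) (u : V), dist u depot ≤ walkLength depot u L := by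
    intro L
    induction L with
    | nil => exact fun u => le_rfl
    | cons w L ih => exact fun u => (dist_triangle u w depot).trans (by
        rw [walkLength]; linarith [ih w])
  induction L generalizing u with
  | nil => simp at h
  | cons w L ih =>
    rw [walkLength]
    rcases List.mem_cons.1 h with rfl | h
    · linarith [key L v]
    · linarith [ih w h, dist_triangle u w v]

theorem one_le_tourLength_star {n : ℕ} (j : Fin n) (L : List (Option (Fin n)))
    (h : some j ∈ L) : 1 ≤ @tourLength _ (starMetric n) none L := by
  let _ := starMetric n
  have h1 := dist_add_dist_le_walkLength none none (some j) h
  rw [dist_comm none (some j)] at h1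
  have h2 : dist (some j) none = ((j : ℝ) + 1) / 2 := by
    change (if some j = none then (0 : ℝ) else _) = _
    simp [biddingCost]
  rw [h2] at h1
  unfold tourLength
  linarith [Nat.cast_nonneg (α := ℝ) (j : ℕ)]

/-- Each leaf is charged half its cost on arrival and half on departure. -/
theorem tourLength_star {n : ℕ} (L : List (Option (Fin n))) (h : L.Nodup) :
    @tourLength _ (starMetric n) none L = knapsackCost (biddingCost n) L := by
  let _ := starMetric n
  have h0 : (biddingCost n none : ℝ) = 0 := rfl
  have hd : ∀ u v : Option (Fin n), (u = v → u = none) →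
      dist u v = ((biddingCost n u : ℝ) + biddingCost n v) / 2 := by
    intro u v huv
    change (if u = v then (0 : ℝ) else _) = _
    split_ifs with h
    · have := huv h
      subst h; rw [this, h0]; ring
    · rfl
  -- The start `u` still owes its departure half. It may recur in `L` only as the depot, whose cost
  -- is zero.
  have key : ∀ (L : List (Option (Fin n))) (u : Option (Fin n)), L.Nodup →
      (u ∈ L → u = none) →
      walkLength none u L = (biddingCost n u : ℝ) / 2 + knapsackCost (biddingCost n) L := by
    intro L
    induction L with
    | nil =>
      intro u _ _
      rw [walkLength, hd u none id, h0]; simp [knapsackCost]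
    | cons v L ih =>
      intro u hL hu
      obtain ⟨hvL, hL⟩ := List.nodup_cons.1 hL
      rw [walkLength, hd u v fun e => hu (by simp [e]), ih v hL fun e => absurd e hvL,
        knapsackCost_cons]
      ring
  rw [tourLength, key L none h fun _ => rfl, h0]; simp

/-! ### Passage to the adaptivity gaps -/

theorem biddingModel_singleRandom (n : ℕ) (p : PMF (Fin n)) : (biddingModel n p).SingleRandom := by
  refine ⟨none, fun v hv => ?_⟩
  cases v with
  | none => exact absurd rfl hv
  | some j => exact ⟨_, rfl⟩

theorem one_le_knapsackCost_bidding {n : ℕ} (j : Fin n) (L : List (Option (Fin n)))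
    (h : some j ∈ L) : 1 ≤ knapsackCost (biddingCost n) L := by
  induction L with
  | nil => simp at h
  | cons v L ih =>
    rw [knapsackCost_cons]
    rcases List.mem_cons.1 h with rfl | h
    · have : (biddingCost n (some j) : ℝ) = (j : ℝ) + 1 := by simp [biddingCost]
      linarith [knapsackCost_nonneg (biddingCost n) L, Nat.cast_nonneg (α := ℝ) (j : ℕ)]
    · exact (ih h).trans (le_add_of_nonneg_left (biddingCost n v).2)

theorem starKTSPAdaptivityGap_le : starKTSPAdaptivityGap ≤ kTSPAdaptivityGap := by
  unfold starKTSPAdaptivityGap kTSPAdaptivityGap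
  gcongr
  exact iSup₂_le fun _ _ => le_rfl

theorem RewardModel.ofReal_le_gapRatio {V : Type} [Fintype V] (M : RewardModel V)
    {len : List V → ℝ} {x : ℝ} (hpos : 0 < M.adaptiveOpt len)
    (h : x * M.adaptiveOpt len ≤ M.nonAdaptiveOpt len) : ENNReal.ofReal x ≤ M.gapRatio len :=
  ENNReal.ofReal_le_ofReal ((le_div_iff₀ hpos).2 h)

theorem ofReal_exp_one_le_of_tendsto {δ : ℕ → ℝ} (hδ : Tendsto δ atTop (𝓝 0)) {g : ℝ≥0∞}
    (h : ∀ n, 1 ≤ n → ENNReal.ofReal (Real.exp 1 - δ n) ≤ g) : ENNReal.ofReal (Real.exp 1) ≤ g := by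
  have h1 : Tendsto (fun n => ENNReal.ofReal (Real.exp 1 - δ n)) atTop
      (𝓝 (ENNReal.ofReal (Real.exp 1 - 0))) :=
    ENNReal.tendsto_ofReal (tendsto_const_nhds.sub hδ)
  rw [sub_zero] at h1
  exact le_of_tendsto h1 ((eventually_ge_atTop 1).mono h)

theorem mainTheorem2 :
    (∃ δ : ℕ → ℝ, Tendsto δ atTop (𝓝 0) ∧
      ∀ n : ℕ, 1 ≤ n → ∃ p : PMF (Fin n),
        0 < (biddingModel n p).adaptiveOpt (knapsackCost (biddingCost n)) ∧
        (Real.exp 1 - δ n) * (biddingModel n p).adaptiveOpt (knapsackCost (biddingCost n)) ≤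
          (biddingModel n p).nonAdaptiveOpt (knapsackCost (biddingCost n))) ∧
    ENNReal.ofReal (Real.exp 1) ≤ knapsackCoverAdaptivityGap ∧
    ENNReal.ofReal (Real.exp 1) ≤ starKTSPAdaptivityGap ∧
    ENNReal.ofReal (Real.exp 1) ≤ kTSPAdaptivityGap := by
  let δ : ℕ → ℝ := fun n => Real.exp 1 - ⨆ m, truncatedRatio n m
  have hδ : Tendsto δ atTop (𝓝 0) := by
    simpa using (tendsto_const_nhds (x := Real.exp 1)).sub tendsto_iSup_truncatedRatio
  have hratio : ∀ (n : ℕ) (hn : 1 ≤ n) (len : List (Option (Fin n)) → ℝ),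
      (∀ j L, some j ∈ L → 1 ≤ len L) →
      (∀ L, L.Nodup → len L = knapsackCost (biddingCost n) L) →
      (Real.exp 1 - δ n) * (biddingModel n (thresholdPMF n hn)).adaptiveOpt len ≤
        (biddingModel n (thresholdPMF n hn)).nonAdaptiveOpt len := fun n hn len hpos hlen => by
    rw [sub_sub_cancel]
    exact iSup_truncatedRatio_mul_adaptiveOpt_le hn hpos hlen
  have hstar : ENNReal.ofReal (Real.exp 1) ≤ starKTSPAdaptivityGap := by
    refine ofReal_exp_one_le_of_tendsto hδ fun n hn => ?_
    refine (RewardModel.ofReal_le_gapRatio _ (adaptiveOpt_pos hn one_le_tourLength_star)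
      (hratio n hn _ one_le_tourLength_star tourLength_star)).trans ?_
    unfold starKTSPAdaptivityGap
    exact le_iSup_of_le (Option (Fin n)) <| le_iSup_of_le inferInstance <|
      le_iSup_of_le (starMetric n) <| le_iSup_of_le none <|
      le_iSup_of_le (biddingModel n (thresholdPMF n hn)) <|
      le_iSup_of_le (isWeightedStar_starMetric n) <|
      le_iSup_of_le (biddingModel_singleRandom n _) le_rfl
  refine ⟨⟨δ, hδ, fun n hn => ⟨thresholdPMF n hn, adaptiveOpt_pos hn one_le_knapsackCost_bidding,
    hratio n hn _ one_le_knapsackCost_bidding fun _ _ => rfl⟩⟩, ?_, hstar,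
    hstar.trans starKTSPAdaptivityGap_le⟩
  refine ofReal_exp_one_le_of_tendsto hδ fun n hn => ?_
  refine (RewardModel.ofReal_le_gapRatio _ (adaptiveOpt_pos hn one_le_knapsackCost_bidding)
    (hratio n hn _ one_le_knapsackCost_bidding fun _ _ => rfl)).trans ?_
  unfold knapsackCoverAdaptivityGap
  exact le_iSup_of_le (Option (Fin n)) <| le_iSup_of_le inferInstance <|
    le_iSup_of_le (biddingCost n) <| le_iSup_of_le (biddingModel n (thresholdPMF n hn)) <|
    le_iSup_of_le (biddingModel_singleRandom n _) le_rfl
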